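/- All spaces are path-connected. For a metric space $X$ and $k\ge 1$, let $\mathcal B_k(X)$ be the set of Borel probability measures $\mu=\sum_{i=1}^k a_i\delta_{x_i}$ on $X$ (with $a_i\ge 0$, $\sum_i a_i=1$), with the topology of the Lévy–Prokhorov metric, and $\mathrm{supp}(\mu)=\{x\in X\mid \mu(\{x\})>0\}$. For a map $p\colon E\to B$ with $E$ a metric space, let $E_k(p)=\{\mu\in\mathcal B_k(E)\mid \mathrm{supp}(\mu)\subset p^{-1}(b)\text{ for some }b\in B\}$, and let $\mathcal B_k(p)\colon E_k(p)\to B$ send $\mu$ to that $b$. The distributional sectional category $\mathrm{dsecat}(p)$ is the smallest $n\ge 0$ such that $\mathcal B_{n+1}(p)$ has a continuous section ($\infty$ if there is none). Path spaces carry the uniform metric on paths $I=[0,1]\to X$. For a metric space $X$ with base point $x_0$, $\mathrm{dcat}(X)=\mathrm{dsecat}\big(\{\phi\in X^I\mid\phi(1)=x_0\}\to X,\ \phi\mapsto\phi(0)\big)$, and for $r\ge 2$, $\mathrm{dTC}_r(X)=\mathrm{dsecat}\big(X^I\to X^r,\ \phi\mapsto(\phi(0),\phi(\tfrac1{r-1}),\dots,\phi(\tfrac{r-2}{r-1}),\phi(1))\big)$.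 For $p\colon E\to B$ with $E$ a metric space, let $E^r_B=\{(e_1,\dots,e_r)\in E^r\mid p(e_i)=p(e_j)\ \forall i,j\}$ and $E^I_B=\{\gamma\in E^I\mid p\circ\gamma\text{ is constant}\}$; $\mathrm{dTC}_r[p\colon E\to B]$ is the smallest $n\ge 0$ for which there is a continuous map $s\colon E^r_B\to\mathcal B_{n+1}(E^I_B)$ such that every $\gamma\in\mathrm{supp}(s(e_1,\dots,e_r))$ satisfies $\gamma(\tfrac{i-1}{r-1})=e_i$ for $1\le i\le r$ ($\infty$ if there is none). **Proposition.** Let $G$ be a path-connected topological group whose topology is given by a metric, and let $p\colon E\to B$ be a (locally trivial) principal $G$-bundle, where $E$ is a path-connected metric space and $B$ is a path-connected topological space. Then for every $r\ge 2$ and every choice of base point in $G^{r-1}$, $$\mathrm{dTC}_r[p\colon E\to B]=\mathrm{dTC}_r(G)=\mathrm{dcat}(G^{r-1}).$$ -/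

import Mathlib

open MeasureTheory unitInterval

noncomputable section

namespace DistributionalComplexity

/-- The space of Borel probability measures on a metric space `X`, with the Lévy–Prokhorov
metric. The σ-algebra is always the Borel σ-algebra of `X`. -/
abbrev BorelProb (X : Type*) [MetricSpace X] : Type _ :=
  LevyProkhorov (@ProbabilityMeasure X (borel X))

instance instMetricSpaceBorelProb (X : Type*) [MetricSpace X] : MetricSpace (BorelProb X) :=
  @LevyProkhorov.levyProkhorovDist_metricSpace_probabilityMeasure X (borel X) _
    (@BorelSpace.opensMeasurable X _ (borel X) (@BorelSpace.mk X _ (borel X) rfl))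
    (@BorelSpace.mk X _ (borel X) rfl)

/-- The underlying measure of an element of `BorelProb X`. -/
def BorelProb.measure {X : Type*} [MetricSpace X] (μ : BorelProb X) : @Measure X (borel X) :=
  μ.toMeasure.1

/-- `𝓑ₖ(X)`: the probability measures on `X` concentrated on a set of at most `k` points, with the
topology induced by the Lévy–Prokhorov metric. -/
def FinProb (k : ℕ) (X : Type*) [MetricSpace X] : Set (BorelProb X) :=
  {μ | ∃ S : Finset X, S.card ≤ k ∧ BorelProb.measure μ (↑S : Set X)ᶜ = 0}

/-- The support of a finitely supported measure: the finite set of its atoms. -/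
def FinProb.supp {k : ℕ} {X : Type*} [MetricSpace X] (μ : FinProb k X) : Set X :=
  {x | BorelProb.measure μ.1 {x} ≠ 0}

/-- The support of a finitely supported probability measure is not empty. -/
theorem FinProb.supp_nonempty {k : ℕ} {X : Type*} [MetricSpace X] (μ : FinProb k X) :
    (FinProb.supp μ).Nonempty := by
  obtain ⟨S, -, hS⟩ := μ.2
  by_contra h
  rw [Set.not_nonempty_iff_eq_empty] at h
  have h0 : ∀ x, BorelProb.measure μ.1 {x} = 0 := by
    intro x
    by_contra hx
    have hx' : x ∈ FinProb.supp μ := hx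
    rw [h] at hx'
    exact hx'
  have hS' : BorelProb.measure μ.1 (↑S : Set X) = 0 := by
    have e : (↑S : Set X) = ⋃ x ∈ (↑S : Set X), {x} := (Set.biUnion_of_singleton _).symm
    rw [e]
    exact (measure_biUnion_null_iff S.countable_toSet).2 fun x _ => h0 x
  have h1 : BorelProb.measure μ.1 Set.univ = 1 := μ.1.toMeasure.2.measure_univ
  have h2 := measure_union_le (μ := BorelProb.measure μ.1) (↑S : Set X) (↑S : Set X)ᶜ
  rw [Set.union_compl_self, h1, hS', hS] at h2
  simp at h2

/-- `Eₖ(p)`: the measures in `𝓑ₖ(E)` whose support lies in a single fibre of `p : E → B`. -/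
def FibProb (k : ℕ) {E B : Type*} [MetricSpace E] (p : E → B) : Set (FinProb k E) :=
  {μ | ∃ b : B, FinProb.supp μ ⊆ p ⁻¹' {b}}

/-- The map `𝓑ₖ(p) : Eₖ(p) → B`, sending a measure to the point over which it is supported. -/
def FibProb.proj {k : ℕ} {E B : Type*} [MetricSpace E] {p : E → B} (μ : FibProb k p) : B :=
  μ.2.choose

theorem FibProb.proj_eq_iff {k : ℕ} {E B : Type*} [MetricSpace E] {p : E → B}
    (μ : FibProb k p) (b : B) : FibProb.proj μ = b ↔ FinProb.supp μ.1 ⊆ p ⁻¹' {b} := by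
  have h : FinProb.supp μ.1 ⊆ p ⁻¹' {FibProb.proj μ} := μ.2.choose_spec
  constructor
  · rintro rfl
    exact h
  · intro h'
    obtain ⟨x, hx⟩ := FinProb.supp_nonempty μ.1
    have h1 : p x = FibProb.proj μ := h hx
    have h2 : p x = b := h' hx
    rw [← h1, h2]

/-- The distributional sectional category of `p : E → B`: the smallest `n` such that
`𝓑ₙ₊₁(p) : Eₙ₊₁(p) → B` has a continuous section, and `⊤` if there is no such `n`. -/
def dsecat {E B : Type*} [MetricSpace E] [TopologicalSpace B] (p : E → B) : ℕ∞ :=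
  ⨅ (n : ℕ) (_ : ∃ s : C(B, FibProb (n + 1) p), ∀ b, FibProb.proj (s b) = b), (n : ℕ∞)

/-- The space `P₀(X)` of paths in `X` that end at the base point `x₀`. -/
def basedPaths (X : Type*) [TopologicalSpace X] (x₀ : X) : Set C(I, X) :=
  {φ | φ 1 = x₀}

/-- The distributional category of the pointed metric space `(X, x₀)`: the distributional
sectional category of the evaluation `P₀(X) → X`, `φ ↦ φ(0)`. -/
def dcat (X : Type*) [MetricSpace X] (x₀ : X) : ℕ∞ :=
  dsecat (fun φ : basedPaths X x₀ => φ.1 0)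

/-- The time `i / (r - 1)`, for `i = 0, …, r - 1`. -/
def node (r : ℕ) (i : Fin r) : I :=
  ⟨(i : ℝ) / ((r : ℝ) - 1), by
    have h : (i : ℝ) ≤ (r : ℝ) - 1 := by
      have : ((i : ℕ) : ℝ) + 1 ≤ (r : ℝ) := by exact_mod_cast i.2
      linarith
    have h0 : (0 : ℝ) ≤ (i : ℝ) := Nat.cast_nonneg _
    exact unitInterval.div_mem h0 (h0.trans h) h⟩

/-- The path fibration `π_r : X^I → X^r`, evaluating a path at the times `i / (r - 1)`. -/
def pathEval (r : ℕ) (X : Type*) [TopologicalSpace X] (φ : C(I, X)) : Fin r → X :=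
  fun i => φ (node r i)

/-- The `r`-th sequential distributional complexity of a metric space `X`. -/
def dTC (r : ℕ) (X : Type*) [MetricSpace X] : ℕ∞ :=
  dsecat (pathEval r X)

/-- `E^I_B`: the paths in `E` that lie in a single fibre of `p`. As a space it carries the
compact-open topology, given by the uniform metric. -/
def fibPaths {E B : Type*} [TopologicalSpace E] (p : E → B) : Set C(I, E) :=
  {γ | ∃ b : B, ∀ t, p (γ t) = b}

/-- The fibre product `E^r_B`, a subspace of `E^r`. -/
def fibProduct (r : ℕ) {E B : Type*} (p : E → B) : Set (Fin r → E) :=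
  {e | ∀ i j, p (e i) = p (e j)}

/-- `E^I_B(e₁, …, e_r)`: the paths in `E^I_B` passing through the given points at the times
`i / (r - 1)`. -/
def fibPathsThrough {r : ℕ} {E B : Type*} [TopologicalSpace E] (p : E → B) (e : Fin r → E) :
    Set (fibPaths p) :=
  {γ | ∀ i, γ.1 (node r i) = e i}

/-- An `r`-th sequential parametrized `k`-distributed navigation algorithm for `p`: a continuous
map `s : E^r_B → 𝓑ₖ(E^I_B)` with `s(e) ∈ 𝓑ₖ(E^I_B(e))` for all `e ∈ E^r_B`. -/
structure NavigationAlgorithm (r k : ℕ) {E B : Type*} [MetricSpace E] (p : E → B) where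
  /-- The underlying map. -/
  toMap : C(fibProduct r p, FinProb k (fibPaths p))
  supp_subset : ∀ e : fibProduct r p, FinProb.supp (toMap e) ⊆ fibPathsThrough p e.1

/-- The `r`-th sequential parametrized distributional complexity of `p : E → B`: the smallest `n`
such that `p` has an `r`-th sequential parametrized `(n+1)`-distributed navigation algorithm, and
`⊤` if there is no such `n`. -/
def paramDTC (r : ℕ) {E B : Type*} [MetricSpace E] (p : E → B) : ℕ∞ :=
  ⨅ (n : ℕ) (_ : Nonempty (NavigationAlgorithm r (n + 1) p)), (n : ℕ∞)

/-- `p : E → B` is a principal `G`-bundle, for a continuous right action of `G` on `E` (a left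
action of the opposite group): the action preserves the fibres of `p`, and every point of `B` has
an open neighbourhood `U` with a homeomorphism `p⁻¹(U) ≅ U × G` over `U` that is equivariant for
right translation on the factor `G`. -/
structure IsPrincipalBundle (G : Type*) {E B : Type*} [TopologicalSpace G] [Group G]
    [TopologicalSpace E] [TopologicalSpace B] [MulAction Gᵐᵒᵖ E] (p : E → B) : Prop where
  continuous_action : ContinuousSMul Gᵐᵒᵖ E
  proj_smul : ∀ (g : G) (x : E), p (MulOpposite.op g • x) = p x
  locally_trivial : ∀ b : B, ∃ φ : Bundle.Trivialization G p, b ∈ φ.baseSet ∧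
    ∀ (x : E) (g : G), p x ∈ φ.baseSet → (φ (MulOpposite.op g • x)).2 = (φ x).2 * g

end DistributionalComplexity

end


/-!
A map into `Z` that is defined and continuous only on the graph of a set-valued map `R` pushes a
continuous family of finitely supported measures on the values of `R` forward to a continuous family
on `Z`, because near a given parameter the Lévy–Prokhorov distance sees the map only near finitely
many points of the graph. All the invariants involved count the atoms of such families, so it
suffices to exhibit continuous maps between the spaces of admissible paths.

* In a principal bundle the translation function turns a path in a fibre into a path in `G`, and the
  action turns it back.
* A path `γ` in `G` with `γ 0 = 1` and `γ (i / n) = xᵢ` yields the path `t ↦ (γ ((1 - t) i / n))ᵢ`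
  from `x` to `1` in `Gⁿ`. Conversely, given `g₀, …, gₙ`, a path in `Gⁿ` from `1` to
  `(g₀⁻¹ g₁, …, gₙ₋₁⁻¹ gₙ)` yields a path through the `gᵢ`: start at `g₀` and multiply on the right
  by the coordinates, running each of them during the corresponding time step.
* A distributed family of paths to the base point contains a path from any other point, so base
  points can be changed by concatenation.
-/

open Filter Topology
open scoped ENNReal

namespace DistributionalComplexity

section Measure

variable {X Z : Type*} [MeasurableSpace X] [MeasurableSpace Z]

theorem aemeasurable_of_ae_mem_countable [MeasurableSingletonClass X] {μ : Measure X} {S : Set X}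
    (hS : S.Countable) (hμ : ∀ᵐ x ∂μ, x ∈ S) (F : X → Z) : AEMeasurable F μ := by
  have := hS.to_subtype
  rw [← Measure.restrict_eq_self_of_ae_mem hμ,
    aemeasurable_restrict_iff_comap_subtype hS.measurableSet]
  exact Measurable.of_discrete.aemeasurable

theorem ae_measure_singleton_ne_zero {μ : Measure X} {S : Set X} (hS : S.Countable)
    (hμ : ∀ᵐ x ∂μ, x ∈ S) : ∀ᵐ x ∂μ, μ {x} ≠ 0 := by
  have hatom : ∀ a ∈ S, ∀ᵐ x ∂μ, x = a → μ {a} ≠ 0 := fun a _ => by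
    by_cases ha : μ {a} = 0
    · filter_upwards [measure_eq_zero_iff_ae_notMem.1 ha] with x hx hxa using absurd hxa hx
    · exact Eventually.of_forall fun _ _ => ha
  filter_upwards [hμ, (ae_ball_iff hS).2 hatom] with x hx h using h x hx rfl

theorem levyProkhorovEDist_map_le [PseudoEMetricSpace X] [PseudoEMetricSpace Z]
    [OpensMeasurableSpace Z] {μ ν : Measure X} [IsProbabilityMeasure μ] [IsProbabilityMeasure ν]
    {F G : X → Z} (hF : AEMeasurable F μ) (hG : AEMeasurable G ν)
    {S T : Set X} (hS : ∀ᵐ x ∂μ, x ∈ S) (hT : ∀ᵐ y ∂ν, y ∈ T) {δ ε : ℝ≥0∞} (hδε : δ ≤ ε)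
    (hμν : levyProkhorovEDist μ ν < δ)
    (hFG : ∀ x ∈ S, ∀ y ∈ T, edist x y < δ → edist (F x) (G y) < ε) :
    levyProkhorovEDist (μ.map F) (ν.map G) ≤ ε := by
  have := Measure.isProbabilityMeasure_map hF
  have := Measure.isProbabilityMeasure_map hG
  refine levyProkhorovEDist_le_of_forall_le _ _ _ fun η A hη hη_top hA => ?_
  rw [Measure.map_apply_of_aemeasurable hF hA,
    Measure.map_apply_of_aemeasurable hG Metric.isOpen_thickening.measurableSet]
  -- `F ⁻¹' A ∩ S` is only null-measurable: use a measurable subset of the same measure.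
  have hA_ae : (F ⁻¹' A ∩ S : Set X) =ᵐ[μ] F ⁻¹' A := inter_ae_eq_left_of_ae_eq_univ <|
    eventuallyEq_univ.2 hS
  obtain ⟨A', hA'_sub, hA', hA'_ae⟩ :=
    ((hF.nullMeasurableSet_preimage hA).congr hA_ae.symm).exists_measurable_subset_ae_eq
  have hthick : Metric.thickening δ.toReal A' ∩ T ⊆ G ⁻¹' Metric.thickening η.toReal A := by
    rintro y ⟨hy, hyT⟩
    obtain ⟨x, hx, hyx⟩ := (Metric.mem_thickening_iff_exists_edist_lt _ _).1 hy
    obtain ⟨hxA, hxS⟩ := hA'_sub hx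
    refine (Metric.mem_thickening_iff_exists_edist_lt _ _).2 ⟨F x, hxA, ?_⟩
    rw [ENNReal.ofReal_toReal (hδε.trans_lt (hη.trans hη_top)).ne, edist_comm] at hyx
    rw [ENNReal.ofReal_toReal hη_top.ne, edist_comm]
    exact (hFG x hxS y hyT hyx).trans hη
  calc μ (F ⁻¹' A) = μ A' := measure_congr (hA'_ae.trans hA_ae).symm
    _ ≤ ν (Metric.thickening δ.toReal A') + δ := left_measure_le_of_levyProkhorovEDist_lt hμν hA'
    _ = ν (Metric.thickening δ.toReal A' ∩ T) + δ := by
        rw [measure_inter_conull (show ν Tᶜ = 0 from hT)]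
    _ ≤ ν (G ⁻¹' Metric.thickening η.toReal A) + η :=
        add_le_add (measure_mono hthick) (hδε.trans hη.le)

end Measure

theorem exists_eventually_edist_lt_of_finite {Y X Z : Type*} [TopologicalSpace Y]
    [PseudoEMetricSpace X] [PseudoEMetricSpace Z] {F : Y × X → Z} {T : Set (Y × X)}
    (hF : ContinuousOn F T) {y₀ : Y} {S : Set X} (hS : S.Finite) (hST : ∀ x ∈ S, (y₀, x) ∈ T)
    {ε : ℝ≥0∞} (hε : 0 < ε) :
    ∃ δ > 0, ∀ᶠ y in 𝓝 y₀, ∀ x' ∈ S, ∀ x, (y, x) ∈ T → edist x x' < δ →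
      edist (F (y, x)) (F (y₀, x')) < ε := by
  induction S, hS using Set.Finite.induction_on with
  | empty => exact ⟨1, one_pos, by simp⟩
  | @insert a S _ _ ih =>
    rw [Set.forall_mem_insert] at hST
    obtain ⟨δ₁, hδ₁, hS⟩ := ih hST.2
    have ha := EMetric.tendsto_nhds.1 (hF (y₀, a) hST.1) ε hε
    rw [eventually_nhdsWithin_iff, nhds_prod_eq] at ha
    obtain ⟨U, hU, V, hV, hUV⟩ := eventually_prod_iff.1 ha
    obtain ⟨δ₂, hδ₂, hδ₂V⟩ := EMetric.mem_nhds_iff.1 hV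
    refine ⟨min δ₁ δ₂, lt_min hδ₁ hδ₂, ?_⟩
    filter_upwards [hU, hS] with y hyU hyS
    refine Set.forall_mem_insert.2 ⟨fun x hxT hx => ?_, fun x' hx' x hxT hx => ?_⟩
    · exact hUV hyU (hδ₂V (hx.trans_le (min_le_right _ _))) hxT
    · exact hyS x' hx' x hxT (hx.trans_le (min_le_left _ _))

namespace FinProb

variable {k : ℕ} {X : Type*} [MetricSpace X]

theorem finite_supp (μ : FinProb k X) : (supp μ).Finite := by
  obtain ⟨S, -, hS⟩ := μ.2
  refine S.finite_toSet.subset fun x hx => ?_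
  by_contra hxS
  exact hx (measure_mono_null (Set.singleton_subset_iff.2 hxS) hS)

theorem ae_mem_supp (μ : FinProb k X) : ∀ᵐ x ∂BorelProb.measure μ.1, x ∈ supp μ := by
  borelize X
  obtain ⟨S, -, hS⟩ := μ.2
  exact ae_measure_singleton_ne_zero S.countable_toSet hS

theorem aemeasurable {Z : Type*} [MeasurableSpace Z] (F : X → Z) (μ : FinProb k X) :
    @AEMeasurable X Z _ (borel X) F (BorelProb.measure μ.1) := by
  borelize X
  exact aemeasurable_of_ae_mem_countable (finite_supp μ).countable (ae_mem_supp μ) F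

variable {Z : Type*} [MetricSpace Z]

/-- The pushforward of a finitely supported probability measure. The map need not be measurable or
continuous, because every map is almost everywhere measurable for such a measure. -/
noncomputable def map (F : X → Z) (μ : FinProb k X) : FinProb k Z :=
  letI := borel X
  letI := borel Z
  haveI : BorelSpace X := ⟨rfl⟩
  haveI : BorelSpace Z := ⟨rfl⟩
  ⟨.ofMeasure (μ.1.toMeasure.map (aemeasurable F μ)), by
    classical
    obtain ⟨S, hk, hS⟩ := μ.2
    refine ⟨S.image F, Finset.card_image_le.trans hk, ?_⟩
    refine (mem_ae_map_iff (aemeasurable F μ) (S.image F).measurableSet).2 ?_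
    filter_upwards [show ∀ᵐ x ∂BorelProb.measure μ.1, x ∈ S from hS] with x hx
    exact Finset.mem_coe.2 (Finset.mem_image_of_mem F hx)⟩

theorem measure_map (F : X → Z) (μ : FinProb k X) : BorelProb.measure (map F μ).1 =
    @Measure.map X Z (borel X) (borel Z) F (BorelProb.measure μ.1) :=
  rfl

theorem supp_map_subset (F : X → Z) (μ : FinProb k X) : supp (map F μ) ⊆ F '' supp μ := by
  borelize X Z
  intro z hz
  have hz' : BorelProb.measure μ.1 (F ⁻¹' {z}) ≠ 0 := by
    rwa [← Measure.map_apply_of_aemeasurable (aemeasurable F μ) (measurableSet_singleton z),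
      ← measure_map]
  obtain ⟨x, hxz, hx⟩ :=
    Measure.exists_mem_of_measure_ne_zero_of_ae hz' (ae_restrict_of_ae (ae_mem_supp μ))
  exact ⟨x, hx, hxz⟩

theorem continuous_map {Y : Type*} [TopologicalSpace Y] {s : Y → FinProb k X} (hs : Continuous s)
    {F : Y × X → Z} {T : Set (Y × X)} (hF : ContinuousOn F T)
    (hT : ∀ y, ∀ x ∈ supp (s y), (y, x) ∈ T) :
    Continuous fun y => map (fun x => F (y, x)) (s y) := by
  refine continuous_induced_rng.2 (continuous_iff_continuousAt.2 fun y₀ => ?_)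
  refine EMetric.tendsto_nhds.2 fun η hη => ?_
  obtain ⟨ε, hε, hεη⟩ := exists_between hη
  obtain ⟨δ, hδ, hnear⟩ :=
    exists_eventually_edist_lt_of_finite hF (finite_supp (s y₀)) (hT y₀) hε
  filter_upwards [hnear, EMetric.tendsto_nhds.1 hs.continuousAt (min δ ε) (lt_min hδ hε)]
    with y hy hsy
  borelize X Z
  have : IsProbabilityMeasure (BorelProb.measure (s y).1) := (s y).1.toMeasure.2
  have : IsProbabilityMeasure (BorelProb.measure (s y₀).1) := (s y₀).1.toMeasure.2
  refine lt_of_le_of_lt ?_ hεη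
  exact levyProkhorovEDist_map_le (aemeasurable _ (s y)) (aemeasurable _ (s y₀))
    (ae_mem_supp (s y)) (ae_mem_supp (s y₀)) (min_le_right _ _) hsy fun x hx x' hx' hxx' =>
      hy x' hx' x (hT y x hx) (hxx'.trans_le (min_le_left _ _))

end FinProb

/-- A `k`-distributed selection of a set-valued map `R`: a continuous choice of a probability
measure on at most `k` points of `R y`. The sections of `𝓑ₖ(p)` are those of `b ↦ p ⁻¹' {b}`, and
the navigation algorithms those of `e ↦ E^I_B(e)`. -/
def HasDistributedSelection (k : ℕ) {Y X : Type*} [TopologicalSpace Y] [MetricSpace X]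
    (R : Y → Set X) : Prop :=
  ∃ s : C(Y, FinProb k X), ∀ y, FinProb.supp (s y) ⊆ R y

namespace HasDistributedSelection

variable {k : ℕ} {Y X : Type*} [TopologicalSpace Y] [MetricSpace X] {R : Y → Set X}

theorem nonempty (h : HasDistributedSelection k R) (y : Y) : (R y).Nonempty := by
  obtain ⟨s, hs⟩ := h
  exact (FinProb.supp_nonempty (s y)).mono (hs y)

theorem comp {Y' : Type*} [TopologicalSpace Y'] (h : HasDistributedSelection k R)
    {c : Y' → Y} (hc : Continuous c) : HasDistributedSelection k fun y => R (c y) := by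
  obtain ⟨s, hs⟩ := h
  exact ⟨s.comp ⟨c, hc⟩, fun y => hs (c y)⟩

theorem map {Z : Type*} [MetricSpace Z] {R' : Y → Set Z} (h : HasDistributedSelection k R)
    {F : {q : Y × X | q.2 ∈ R q.1} → Z} (hF : Continuous F) (hFR' : ∀ q, F q ∈ R' q.1.1) :
    HasDistributedSelection k R' := by
  obtain ⟨s, hs⟩ := h
  rcases isEmpty_or_nonempty Y with _ | ⟨⟨y₀⟩⟩
  · exact ⟨⟨isEmptyElim, continuous_of_discreteTopology⟩, isEmptyElim⟩
  obtain ⟨x₀, hx₀⟩ := FinProb.supp_nonempty (s y₀)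
  let F' : Y × X → Z := Function.extend Subtype.val F fun _ => F ⟨(y₀, x₀), hs y₀ hx₀⟩
  have hF' (q) : F' q.1 = F q := Subtype.val_injective.extend_apply _ _ q
  have hF'_cont : ContinuousOn F' {q | q.2 ∈ R q.1} := by
    rw [continuousOn_iff_continuous_domRestrict]
    exact hF.congr fun q => (hF' q).symm
  refine ⟨⟨_, FinProb.continuous_map s.continuous hF'_cont hs⟩, fun y => ?_⟩
  refine (FinProb.supp_map_subset _ _).trans ?_
  rintro _ ⟨x, hx, rfl⟩
  change F' (y, x) ∈ R' y
  rw [hF' ⟨(y, x), hs y hx⟩]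
  exact hFR' ⟨(y, x), hs y hx⟩

end HasDistributedSelection

section DistributedSelection

variable {E B : Type*} [MetricSpace E]

theorem exists_fibProb_section_iff {k : ℕ} [TopologicalSpace B] (p : E → B) :
    (∃ s : C(B, FibProb k p), ∀ b, FibProb.proj (s b) = b) ↔
      HasDistributedSelection k fun b => p ⁻¹' {b} :=
  ⟨fun ⟨s, hs⟩ => ⟨⟨fun b => (s b).1, by fun_prop⟩, fun b => (FibProb.proj_eq_iff _ b).1 (hs b)⟩,
    fun ⟨s, hs⟩ => ⟨⟨fun b => ⟨s b, b, hs b⟩, by fun_prop⟩,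
      fun b => (FibProb.proj_eq_iff _ b).2 (hs b)⟩⟩

theorem nonempty_navigationAlgorithm_iff {r k : ℕ} (p : E → B) :
    Nonempty (NavigationAlgorithm r k p) ↔
      HasDistributedSelection k fun e : fibProduct r p => fibPathsThrough p e.1 :=
  ⟨fun ⟨N⟩ => ⟨N.toMap, N.supp_subset⟩, fun ⟨s, hs⟩ => ⟨⟨s, hs⟩⟩⟩

theorem dsecat_congr [TopologicalSpace B] {E' B' : Type*} [MetricSpace E'] [TopologicalSpace B']
    {p : E → B} {q : E' → B'} (h : ∀ k, (HasDistributedSelection k fun b => p ⁻¹' {b}) ↔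
      HasDistributedSelection k fun b => q ⁻¹' {b}) : dsecat p = dsecat q := by
  simp only [dsecat, exists_fibProb_section_iff, h]

theorem paramDTC_eq_dsecat {r : ℕ} {p : E → B} {E' B' : Type*} [MetricSpace E']
    [TopologicalSpace B'] {q : E' → B'}
    (h : ∀ k, (HasDistributedSelection k fun e : fibProduct r p => fibPathsThrough p e.1) ↔
      HasDistributedSelection k fun b => q ⁻¹' {b}) : paramDTC r p = dsecat q := by
  simp only [paramDTC, dsecat, nonempty_navigationAlgorithm_iff, exists_fibProb_section_iff, h]

end DistributedSelection

section BasePoint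

variable {X : Type*} [MetricSpace X]

theorem HasDistributedSelection.basedPaths_change_basepoint {k : ℕ} {x₀ : X} (x₁ : X)
    (h : HasDistributedSelection k fun x => (fun φ : basedPaths X x₀ => φ.1 0) ⁻¹' {x}) :
    HasDistributedSelection k fun x => (fun φ : basedPaths X x₁ => φ.1 0) ⁻¹' {x} := by
  obtain ⟨φ₁, hφ₁⟩ := h.nonempty x₁
  let a : Path x₀ x₁ := Path.symm ⟨φ₁.1, hφ₁, φ₁.2⟩
  let T : Set (X × basedPaths X x₀) := {q | q.2.1 0 = q.1}
  let path (q : T) : Path q.1.1 x₀ := ⟨q.1.2.1, q.2, q.1.2.2⟩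
  have hpath : Continuous ↿path :=
    (by fun_prop : Continuous fun z : T × I => z.1.1.2.1 z.2)
  refine h.map (F := fun q : T => ⟨(path q).trans a, Path.target _⟩) (Continuous.subtype_mk ?_ _)
    fun q : T => Path.source _
  exact ContinuousMap.continuous_of_continuous_uncurry _ <|
    Path.trans_continuous_family path hpath (fun _ => a) (a.continuous.comp continuous_snd)

theorem dcat_eq_dcat (x₀ x₁ : X) : dcat X x₀ = dcat X x₁ :=
  dsecat_congr fun _ => ⟨.basedPaths_change_basepoint x₁, .basedPaths_change_basepoint x₀⟩

end BasePoint

section Translation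

/-- The element of `G` that takes `x` to `y`, for two points of a fibre of a principal `G`-bundle;
an arbitrary element of `G` if there is no such element. -/
noncomputable def translation (G : Type*) {E : Type*} [Group G] [MulAction Gᵐᵒᵖ E] (x y : E) : G :=
  Classical.epsilon fun g => MulOpposite.op g • x = y

variable {G E B : Type*} [Group G] [MulAction Gᵐᵒᵖ E] [TopologicalSpace G] [TopologicalSpace E]
  [TopologicalSpace B] {p : E → B}

namespace IsPrincipalBundle

theorem op_smul_eq_of_trivialization (hp : IsPrincipalBundle G p) {φ : Bundle.Trivialization G p}
    (hφ : ∀ (x : E) (g : G), p x ∈ φ.baseSet → (φ (MulOpposite.op g • x)).2 = (φ x).2 * g)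
    {x y : E} (hx : p x ∈ φ.baseSet) (hxy : p x = p y) :
    MulOpposite.op ((φ x).2⁻¹ * (φ y).2) • x = y := by
  have hy : p y ∈ φ.baseSet := hxy ▸ hx
  have hgx (g : G) : p (MulOpposite.op g • x) ∈ φ.baseSet := (hp.proj_smul g x).symm ▸ hx
  refine φ.injOn (φ.mem_source.2 (hgx _)) (φ.mem_source.2 hy) (Prod.ext ?_ ?_)
  · exact (φ.coe_fst' (hgx _)).trans (((hp.proj_smul _ _).trans hxy).trans (φ.coe_fst' hy).symm)
  · exact (hφ x _ hx).trans (mul_inv_cancel_left _ _)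

theorem op_translation_smul (hp : IsPrincipalBundle G p) {x y : E} (hxy : p x = p y) :
    MulOpposite.op (translation G x y) • x = y := by
  obtain ⟨φ, hx, hφ⟩ := hp.locally_trivial (p x)
  exact Classical.epsilon_spec (p := fun g : G => MulOpposite.op g • x = y)
    ⟨_, hp.op_smul_eq_of_trivialization hφ hx hxy⟩

theorem translation_op_smul (hp : IsPrincipalBundle G p) (x : E) (g : G) :
    translation G x (MulOpposite.op g • x) = g := by
  obtain ⟨φ, hx, hφ⟩ := hp.locally_trivial (p x)
  have h := congrArg (fun y => (φ y).2) (hp.op_translation_smul (hp.proj_smul g x).symm)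
  simpa only [hφ _ _ hx, mul_right_inj] using h

theorem continuous_translation [IsTopologicalGroup G] (hp : IsPrincipalBundle G p) {Y : Type*}
    [TopologicalSpace Y] {f g : Y → E} (hf : Continuous f) (hg : Continuous g)
    (hfg : ∀ y, p (f y) = p (g y)) : Continuous fun y => translation G (f y) (g y) := by
  refine continuous_iff_continuousAt.2 fun y => ?_
  obtain ⟨φ, hφy, hφ⟩ := hp.locally_trivial (p (f y))
  have hfy : f y ∈ φ.source := φ.mem_source.2 hφy
  have hgy : g y ∈ φ.source := φ.mem_source.2 (hfg y ▸ hφy)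
  have hcoord : ContinuousAt (fun y' => (φ (f y')).2⁻¹ * (φ (g y')).2) y :=
    ((φ.continuousAt hfy).comp hf.continuousAt).snd.inv.mul
      ((φ.continuousAt hgy).comp hg.continuousAt).snd
  refine hcoord.congr ?_
  filter_upwards [hf.continuousAt (φ.open_source.mem_nhds hfy)] with y' hy'
  have h := hp.op_smul_eq_of_trivialization hφ (φ.mem_source.1 hy') (hfg y')
  rw [← hp.translation_op_smul (f y') ((φ (f y')).2⁻¹ * (φ (g y')).2), h]

end IsPrincipalBundle

end Translation

section PrincipalBundle

variable {G E B : Type*} [MetricSpace G] [Group G] [IsTopologicalGroup G] [MetricSpace E]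
  [TopologicalSpace B] [MulAction Gᵐᵒᵖ E] {p : E → B}

theorem HasDistributedSelection.pathEval_of_fibPathsThrough [Nonempty E]
    (hp : IsPrincipalBundle G p) {n k : ℕ}
    (h : HasDistributedSelection k fun e : fibProduct (n + 1) p => fibPathsThrough p e.1) :
    HasDistributedSelection k fun g => pathEval (n + 1) G ⁻¹' {g} := by
  have := hp.continuous_action
  obtain ⟨e⟩ := ‹Nonempty E›
  let orbit (g : Fin (n + 1) → G) : fibProduct (n + 1) p :=
    ⟨fun i => MulOpposite.op (g i) • e, fun i j => by rw [hp.proj_smul, hp.proj_smul]⟩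
  have horbit : Continuous orbit := Continuous.subtype_mk (by fun_prop) _
  let T : Set ((Fin (n + 1) → G) × fibPaths p) := {q | q.2 ∈ fibPathsThrough p (orbit q.1).1}
  have hT (q : T) (t : I) : p e = p (q.1.2.1 t) := by
    obtain ⟨b, hb⟩ := q.1.2.2
    rw [hb t, ← hb (node (n + 1) 0), q.2 0, hp.proj_smul]
  let F : C(T, C(I, G)) := ContinuousMap.curry ⟨fun z => translation G e (z.1.1.2.1 z.2),
    hp.continuous_translation continuous_const (by fun_prop) fun z => hT z.1 z.2⟩
  refine (h.comp horbit).map F.continuous fun q : T => funext fun i => ?_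
  change translation G e (q.1.2.1 (node (n + 1) i)) = q.1.1 i
  rw [q.2 i]
  exact hp.translation_op_smul e _

theorem HasDistributedSelection.fibPathsThrough_of_pathEval (hp : IsPrincipalBundle G p)
    {n k : ℕ} (h : HasDistributedSelection k fun g => pathEval (n + 1) G ⁻¹' {g}) :
    HasDistributedSelection k fun e : fibProduct (n + 1) p => fibPathsThrough p e.1 := by
  have := hp.continuous_action
  let diff (e : fibProduct (n + 1) p) (i : Fin (n + 1)) : G := translation G (e.1 0) (e.1 i)
  have hdiff : Continuous diff := continuous_pi fun i =>
    hp.continuous_translation ((continuous_apply 0).comp continuous_subtype_val)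
      ((continuous_apply i).comp continuous_subtype_val) fun e => e.2 0 i
  let T : Set (fibProduct (n + 1) p × C(I, G)) := {q | pathEval (n + 1) G q.2 = diff q.1}
  have hstart : Continuous fun z : T × I => z.1.1.1.1 0 :=
    (continuous_apply 0).comp (by fun_prop : Continuous fun z : T × I => z.1.1.1.1)
  let H : C(T, C(I, E)) := ContinuousMap.curry
    ⟨fun z => MulOpposite.op (z.1.1.2 z.2) • z.1.1.1.1 0, .smul (by fun_prop) hstart⟩
  let F (q : T) : fibPaths p := ⟨H q, p (q.1.1.1 0), fun t => hp.proj_smul _ _⟩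
  have hF : Continuous F := H.continuous.subtype_mk _
  refine (h.comp hdiff).map hF fun (q : T) i => ?_
  change MulOpposite.op (q.1.2 (node (n + 1) i)) • q.1.1.1 0 = q.1.1.1 i
  have hγ : q.1.2 (node (n + 1) i) = translation G (q.1.1.1 0) (q.1.1.1 i) := congrFun q.2 i
  rw [hγ, hp.op_translation_smul (q.1.1.2 0 i)]

theorem paramDTC_eq_dTC [Nonempty E] (hp : IsPrincipalBundle G p) (n : ℕ) :
    paramDTC (n + 1) p = dTC (n + 1) G :=
  paramDTC_eq_dsecat fun _ => ⟨.pathEval_of_fibPathsThrough hp, .fibPathsThrough_of_pathEval hp⟩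

end PrincipalBundle

section Node

variable {n : ℕ}

theorem node_zero : node (n + 1) 0 = 0 := by
  ext
  simp [node]

theorem natCast_mul_node (hn : n ≠ 0) (i : Fin (n + 1)) : n * (node (n + 1) i : ℝ) = (i : ℕ) := by
  have : (n : ℝ) ≠ 0 := Nat.cast_ne_zero.2 hn
  simp only [node, Nat.cast_add, Nat.cast_one, add_sub_cancel_right]
  field_simp

/-- The time change that rests at `0` until the `j`-th node, runs from `0` to `1` until the next
node, and rests at `1` afterwards. -/
noncomputable def ramp (j : Fin n) : C(I, I) :=
  ⟨fun t => Set.projIcc 0 1 zero_le_one (n * (t : ℝ) - (j : ℕ)),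
    continuous_projIcc.comp (by fun_prop)⟩

theorem ramp_node_of_le {i : Fin (n + 1)} {j : Fin n} (h : i ≤ j.castSucc) :
    ramp j (node (n + 1) i) = 0 := by
  refine Set.projIcc_of_le_left zero_le_one ?_
  rw [natCast_mul_node j.pos.ne', sub_nonpos]
  exact_mod_cast h

theorem ramp_node_of_lt {i : Fin (n + 1)} {j : Fin n} (h : j.castSucc < i) :
    ramp j (node (n + 1) i) = 1 := by
  refine Set.projIcc_of_right_le zero_le_one ?_
  rw [natCast_mul_node j.pos.ne', le_sub_iff_add_le']
  exact_mod_cast h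

end Node

section PartialProd

variable {M : Type*} [Monoid M] {n : ℕ}

theorem partialProd_ite_lt (f : Fin n → M) (i k : Fin (n + 1)) :
    Fin.partialProd (fun j => if j.castSucc < i then f j else 1) k =
      Fin.partialProd f (min k i) := by
  induction k using Fin.induction with
  | zero => simp
  | succ j ih =>
    rw [Fin.partialProd_succ, ih]
    rcases lt_or_ge j.castSucc i with hj | hj
    · rw [if_pos hj, min_eq_left hj.le, min_eq_left (Fin.castSucc_lt_iff_succ_le.1 hj),
        Fin.partialProd_succ]
    · rw [if_neg hj.not_gt, mul_one, min_eq_right hj,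
        min_eq_right (hj.trans j.castSucc_lt_succ.le)]

theorem partialProd_ramp_node {β : Fin n → I → M} (hβ : ∀ j, β j 0 = 1) (i : Fin (n + 1)) :
    Fin.partialProd (fun j => β j (ramp j (node (n + 1) i))) (Fin.last n) =
      Fin.partialProd (fun j => β j 1) i := by
  have hramp : (fun j => β j (ramp j (node (n + 1) i))) =
      fun j => if j.castSucc < i then β j 1 else 1 := by
    ext j
    split_ifs with hj
    · rw [ramp_node_of_lt hj]
    · rw [ramp_node_of_le (not_lt.1 hj), hβ]
  rw [hramp, partialProd_ite_lt, min_eq_right (Fin.le_last i)]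

theorem continuous_partialProd [TopologicalSpace M] [ContinuousMul M] (k : Fin (n + 1)) :
    Continuous fun f : Fin n → M => Fin.partialProd f k := by
  induction k using Fin.induction with
  | zero => simpa only [Fin.partialProd_zero] using continuous_const
  | succ j ih => exact (ih.mul (continuous_apply j)).congr fun f => (Fin.partialProd_succ f j).symm

end PartialProd

section TopologicalGroup

variable {G : Type*} [MetricSpace G]

theorem HasDistributedSelection.basedPaths_of_pathEval [One G] {n k : ℕ}
    (h : HasDistributedSelection k fun g => pathEval (n + 1) G ⁻¹' {g}) :
    HasDistributedSelection k fun x =>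
      (fun φ : basedPaths (Fin n → G) 1 => φ.1 0) ⁻¹' {x} := by
  let cons (x : Fin n → G) : Fin (n + 1) → G := Fin.cons 1 x
  have hcons : Continuous cons := by fun_prop
  let T : Set ((Fin n → G) × C(I, G)) := {q | pathEval (n + 1) G q.2 = cons q.1}
  have hT (q : T) (i) : q.1.2 (node (n + 1) i) = (Fin.cons 1 q.1.1 : Fin (n + 1) → G) i :=
    congrFun q.2 i
  let H : C(T, C(I, Fin n → G)) := ContinuousMap.curry
    ⟨fun z i => z.1.1.2 (σ z.2 * node (n + 1) i.succ), by fun_prop⟩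
  have hH_one (q : T) : H q 1 = 1 := funext fun i => by
    change q.1.2 (σ 1 * node (n + 1) i.succ) = 1
    rw [symm_one, zero_mul, ← node_zero, hT, Fin.cons_zero]
  refine (h.comp hcons).map (F := fun q : T => ⟨H q, hH_one q⟩) (H.continuous.subtype_mk _)
    fun q : T => funext fun i => ?_
  change q.1.2 (σ 0 * node (n + 1) i.succ) = q.1.1 i
  rw [symm_zero, one_mul, hT, Fin.cons_succ]

variable [Group G] [IsTopologicalGroup G]

theorem HasDistributedSelection.pathEval_of_basedPaths {n k : ℕ}
    (h : HasDistributedSelection k fun x =>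
      (fun φ : basedPaths (Fin n → G) 1 => φ.1 0) ⁻¹' {x}) :
    HasDistributedSelection k fun g => pathEval (n + 1) G ⁻¹' {g} := by
  let quot (g : Fin (n + 1) → G) (j : Fin n) : G := (g j.castSucc)⁻¹ * g j.succ
  have hquot : Continuous quot := by fun_prop
  let T : Set ((Fin (n + 1) → G) × basedPaths (Fin n → G) 1) := {q | q.2.1 0 = quot q.1}
  let step (q : T) (j : Fin n) (t : I) : G := q.1.2.1 (σ t) j
  have hstep_zero (q : T) (j) : step q j 0 = 1 := by
    rw [show step q j 0 = q.1.2.1 1 j by simp only [step, symm_zero]]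
    exact congrFun q.1.2.2 j
  have hstep_one (q : T) (j) : step q j 1 = quot q.1.1 j := by
    simpa only [step, symm_one] using congrFun q.2 j
  let F : C(T, C(I, G)) := ContinuousMap.curry
    ⟨fun z => z.1.1.1 0 * Fin.partialProd (fun j => step z.1 j (ramp j z.2)) (Fin.last n),
      .mul (by fun_prop) ((continuous_partialProd _).comp (by fun_prop))⟩
  refine (h.comp hquot).map F.continuous fun q : T => funext fun i => ?_
  calc q.1.1 0 * Fin.partialProd (fun j => step q j (ramp j (node (n + 1) i))) (Fin.last n)
    _ = q.1.1 0 * Fin.partialProd (quot q.1.1) i := by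
      rw [partialProd_ramp_node (hstep_zero q)]
      simp only [hstep_one]
    _ = q.1.1 i := congrFun (Fin.partialProd_left_inv q.1.1) i

theorem dTC_eq_dcat_one (n : ℕ) : dTC (n + 1) G = dcat (Fin n → G) 1 :=
  dsecat_congr fun _ => ⟨.basedPaths_of_pathEval, .pathEval_of_basedPaths⟩

end TopologicalGroup

end DistributionalComplexity

open DistributionalComplexity in
theorem mainTheorem5_general {G E B : Type*} [MetricSpace G] [Group G] [IsTopologicalGroup G]
    [MetricSpace E] [Nonempty E] [TopologicalSpace B] [MulAction Gᵐᵒᵖ E] {p : E → B}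
    (hp : IsPrincipalBundle G p) {r : ℕ} (hr : 2 ≤ r) (x₀ : Fin (r - 1) → G) :
    paramDTC r p = dTC r G ∧ dTC r G = dcat (Fin (r - 1) → G) x₀ := by
  obtain ⟨n, rfl⟩ := Nat.exists_eq_add_of_le' (one_le_two.trans hr)
  exact ⟨paramDTC_eq_dTC hp n, (dTC_eq_dcat_one n).trans (dcat_eq_dcat 1 x₀)⟩

theorem mainTheorem5 {G E B : Type*}
    [MetricSpace G] [Group G] [IsTopologicalGroup G] [PathConnectedSpace G]
    [MetricSpace E] [PathConnectedSpace E] [TopologicalSpace B] [PathConnectedSpace B]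
    [MulAction Gᵐᵒᵖ E] (p : E → B) (hp : DistributionalComplexity.IsPrincipalBundle G p)
    (r : ℕ) (hr : 2 ≤ r) (x₀ : Fin (r - 1) → G) :
    DistributionalComplexity.paramDTC r p = DistributionalComplexity.dTC r G ∧
      DistributionalComplexity.dTC r G =
        DistributionalComplexity.dcat (Fin (r - 1) → G) x₀ :=
  mainTheorem5_general hp hr x₀
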